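/- Let $d\ge 1$ and write $B_r$ for the open ball of radius $r$ centred at the origin of $\mathbb R^d$ and $t_+=\max\{t,0\}$. For every $C\in(0,1)$ there are constants $\varepsilon_0>0$, $\delta\in(0,1)$ and $\rho\in(0,1)$, depending only on $d$ and $C$, such that the following holds. Let $0<\varepsilon\le\varepsilon_0$, $|a|\le 1$ and $\gamma>0$, let $\phi:B_1\to[0,\infty)$ be continuous, set $\Omega=B_1\cap\{\phi>0\}$, and suppose that $$-\Delta\phi=f\quad\text{in }\Omega$$ in the sense of distributions, for some $f\in L^\infty(B_1)$ with $\|f\|_{L^\infty(B_1)}\le\varepsilon_0\,\gamma\,\varepsilon$. Assume that $$\gamma(x_d+a)_+\le\phi(x)\le\gamma(x_d+a+\varepsilon)_+\qquad\text{for all }x\in B_1,$$ and that either $$\{x_d+a+C\varepsilon>0\}\cap B_{1/4}\subset\Omega\qquad\text{or}\qquad\Omega\cap B_{1/4}\subset\{x_d+a+(1-C)\varepsilon>0\}\cap B_{1/4}.$$ Then either $$\phi(x)\ge\gamma(x_d+a+\delta\varepsilon)_+\quad\text{for all }x\in B_\rho,\qquad\text{or}\qquad\phi(x)\le\gamma(x_d+a+(1-\delta)\varepsilon)_+\quad\text{for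 all }x\in B_\rho.$$ -/

import Mathlib

open Set MeasureTheory
open scoped ContDiff ENNReal

namespace GainSpace

/-- Points of `ℝ^d`, `d = n + 1 ≥ 1`, with the Euclidean norm. -/
abbrev E (n : ℕ) : Type := EuclideanSpace ℝ (Fin (n + 1))

/-- The last coordinate `x_d` of `x ∈ ℝ^d`. -/
def lastCoord {n : ℕ} (x : E n) : ℝ := x (Fin.last n)

/-- The ball `B_r` of radius `r` centred at the origin. -/
def B (n : ℕ) (r : ℝ) : Set (E n) := Metric.ball 0 r

/-- The positive part `t_+ = max t 0`. -/
def pos (t : ℝ) : ℝ := max t 0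

/-- The positivity set `Ω = B_1 ∩ {φ > 0}`. -/
def positivitySet {n : ℕ} (φ : E n → ℝ) : Set (E n) := {x | x ∈ B n 1 ∧ 0 < φ x}

/-- The equation `-Δφ = f` in the open set `U`, in the sense of distributions:
`-∫_U φ Δη = ∫_U f η` for every test function `η ∈ C_c^∞(U)`. -/
def SolvesPoisson {n : ℕ} (U : Set (E n)) (φ f : E n → ℝ) : Prop :=
  ∀ η : E n → ℝ, ContDiff ℝ ∞ η → HasCompactSupport η → tsupport η ⊆ U →
    -(∫ x in U, φ x * Laplacian.laplacian η x) = ∫ x in U, f x * η x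

end GainSpace

namespace GainSpace

/-! ### Laplacian of a smooth radial function. -/

section Laplacian

variable {V : Type*} [NormedAddCommGroup V] [InnerProductSpace ℝ V]

/-! Everything rests on an approximate mean value property. For the smooth radial kernel `bump`, the
derivative in `t` of its rescaling to radius `t` is `-t` times the Laplacian of a test function.
Testing `-Δφ = f` with that function bounds the rate of change of the averages of `φ`, and letting
`t → 0` yields `abs_average_sub_le`: the weighted average over radius `s` differs from the centre
value by `O(s² ‖f‖_∞)`. Affine functions average exactly, so the normalised gaps `w = φ/γ - (x_d +
a)` and `w = (x_d + a + ε) - φ/γ` inherit the estimate.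

The scale `l = barrierScale n` separates two regimes. If `a > l`, then `B_l ⊆ Ω` and `0 ≤ w ≤ ε`
there for the first gap. Averages at nearby centres are close, so `w` stays within `ε/4` of `w 0` on
a small ball (`exists_oscillation_radius`), and the comparison of `w 0` with `ε/2` decides which
side improves.

If `a ≤ l`, the inclusion assumed on `Ω` is used. It makes the relevant gap at least `C ε` at points
of a slab outside `Ω`. A quadratic barrier of height `κ = C ε`, whose averages exceed its centre
values by exactly `s² κ`, then lies below the gap (`barrier_le`), because a negative minimum of the
difference would contradict the mean value property. Near the origin the barrier is at least `κ /
2`, which is the gain. -/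

theorem hasFDerivAt_comp_normSq {G : ℝ → ℝ} (hG : Differentiable ℝ G) (x₀ y : V) :
    HasFDerivAt (fun y => G (‖y - x₀‖ ^ 2))
      ((2 * deriv G (‖y - x₀‖ ^ 2)) • innerSL ℝ (y - x₀)) y := by
  have h1 : HasFDerivAt (fun y => ‖y - x₀‖ ^ 2) (2 • (innerSL ℝ (y - x₀))) y := by
    have := ((hasFDerivAt_id (𝕜 := ℝ) y).sub_const x₀).norm_sq
    simpa using this
  have h2 := (hG (‖y - x₀‖ ^ 2)).hasDerivAt.comp_hasFDerivAt y h1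
  refine h2.congr_fderiv ?_
  ext v
  simp
  ring

variable [FiniteDimensional ℝ V]

theorem laplacian_comp_normSq {G : ℝ → ℝ} (hG : ContDiff ℝ ∞ G) (x₀ y : V) :
    Laplacian.laplacian (fun y => G (‖y - x₀‖ ^ 2)) y =
      4 * ‖y - x₀‖ ^ 2 * deriv (deriv G) (‖y - x₀‖ ^ 2) +
        2 * Module.finrank ℝ V * deriv G (‖y - x₀‖ ^ 2) := by
  have hG1 : Differentiable ℝ G := hG.differentiable (by simp)
  have hG2 : Differentiable ℝ (deriv G) := by
    have : ContDiff ℝ ∞ (deriv G) := (contDiff_infty_iff_deriv.1 hG).2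
    exact this.differentiable (by simp)
  obtain ⟨J, hJ⟩ : ∃ J : V →L[ℝ] V →L[ℝ] ℝ, ∀ x, J x = innerSL ℝ x :=
    ⟨innerSL ℝ, fun _ => rfl⟩
  have h1 : fderiv ℝ (fun y => G (‖y - x₀‖ ^ 2)) =
      fun y => (2 * deriv G (‖y - x₀‖ ^ 2)) • J (y - x₀) :=
    funext fun y => by rw [(hasFDerivAt_comp_normSq hG1 x₀ y).fderiv, hJ]
  have h2 : HasFDerivAt (fun y => (2 * deriv G (‖y - x₀‖ ^ 2)) • J (y - x₀))
      ((2 * deriv G (‖y - x₀‖ ^ 2)) • J +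
        ((2 : ℝ) • ((2 * deriv (deriv G) (‖y - x₀‖ ^ 2)) • J (y - x₀))).smulRight
          (J (y - x₀))) y := by
    have ha := (hasFDerivAt_comp_normSq hG2 x₀ y).const_mul 2
    have hb : HasFDerivAt (fun y => J (y - x₀)) J y :=
      J.hasFDerivAt.comp y ((hasFDerivAt_id y).sub_const x₀)
    rw [← hJ] at ha
    exact ha.smul hb
  rw [InnerProductSpace.laplacian_eq_iteratedFDeriv_stdOrthonormalBasis]
  simp only [iteratedFDeriv_two_apply, h1, h2.fderiv]
  set b := stdOrthonormalBasis ℝ V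
  have hs : ∑ i, inner ℝ (y - x₀) (b i) * inner ℝ (y - x₀) (b i) = ‖y - x₀‖ ^ 2 := by
    have := b.sum_sq_norm_inner_left (y - x₀)
    rw [← this]
    refine Finset.sum_congr rfl fun i _ => ?_
    rw [Real.norm_eq_abs, sq_abs, sq]
  have : ∀ i, (((2 * deriv G (‖y - x₀‖ ^ 2)) • J +
        ((2 : ℝ) • ((2 * deriv (deriv G) (‖y - x₀‖ ^ 2)) • J (y - x₀))).smulRight
          (J (y - x₀))) (![b i, b i] 0)) (![b i, b i] 1) =
      2 * deriv G (‖y - x₀‖ ^ 2) + 4 * deriv (deriv G) (‖y - x₀‖ ^ 2) *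
        (inner ℝ (y - x₀) (b i) * inner ℝ (y - x₀) (b i)) := by
    intro i
    generalize y - x₀ = w
    simp [hJ, innerSL_apply_apply]
    ring
  simp only [this]
  rw [Finset.sum_add_distrib, ← Finset.mul_sum, ← Finset.mul_sum, hs]
  simp
  ring

end Laplacian

/-! ### The radial profile and the averaging kernel. -/

/-- A smooth nondecreasing function vanishing on `[1, ∞)`, strictly increasing on `(-∞, 1)`. -/
noncomputable def profile (s : ℝ) : ℝ := -expNegInvGlue (1 - s)

theorem contDiff_profile : ContDiff ℝ ∞ profile :=
  (expNegInvGlue.contDiff.comp (contDiff_const.sub contDiff_id)).neg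

theorem contDiff_deriv_profile : ContDiff ℝ ∞ (deriv profile) :=
  (contDiff_infty_iff_deriv.1 contDiff_profile).2

theorem monotone_profile : Monotone profile := fun a b h =>
  neg_le_neg (expNegInvGlue.monotone (by linarith))

theorem deriv_profile_nonneg (s : ℝ) : 0 ≤ deriv profile s := monotone_profile.deriv_nonneg

theorem profile_eq_zero {s : ℝ} (hs : 1 ≤ s) : profile s = 0 := by
  simp [profile, expNegInvGlue.zero_of_nonpos (sub_nonpos.2 hs)]

theorem abs_profile_le_one {s : ℝ} : |profile s| ≤ 1 := by
  unfold profile expNegInvGlue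
  split_ifs with h
  · simp
  · rw [abs_neg, abs_of_pos (Real.exp_pos _), Real.exp_le_one_iff, neg_nonpos, inv_nonneg]
    linarith

theorem deriv_profile_eq_zero {s : ℝ} (hs : 1 ≤ s) : deriv profile s = 0 := by
  have h : Set.EqOn (deriv profile) 0 (Ioi 1) := fun t ht => by
    have : profile =ᶠ[nhds t] fun _ => 0 := by
      filter_upwards [Ioi_mem_nhds (show (1 : ℝ) < t from ht)] with u hu
      exact profile_eq_zero (le_of_lt hu)
    simpa using this.deriv_eq
  have h2 := h.closure contDiff_deriv_profile.continuous continuous_const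
  rw [closure_Ioi] at h2
  exact h2 hs

theorem deriv_profile_pos {s : ℝ} (hs : s < 1) : 0 < deriv profile s := by
  have hs' : 0 < 1 - s := sub_pos.2 hs
  have h0 : HasDerivAt (fun s : ℝ => 1 - s) (-1) s := by
    simpa using (hasDerivAt_id s).const_sub 1
  have h1 : HasDerivAt (fun s : ℝ => -Real.exp (-(1 - s)⁻¹)) _ s :=
    ((h0.inv hs'.ne').neg.exp).neg
  have heq : profile =ᶠ[nhds s] fun s => -Real.exp (-(1 - s)⁻¹) := by
    filter_upwards [Iio_mem_nhds hs] with u hu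
    have : ¬ (1 - u ≤ 0) := not_le.2 (sub_pos.2 hu)
    simp only [profile, expNegInvGlue, this, if_false]
  rw [heq.deriv_eq, h1.deriv, ← mul_neg, neg_neg, neg_neg]
  positivity

section Bump

variable {V : Type*} [NormedAddCommGroup V]

/-- The radial averaging kernel; `bump z` times `z` is the gradient of `profile (‖z‖ ^ 2)`. -/
noncomputable def bump (z : V) : ℝ := 2 * deriv profile (‖z‖ ^ 2)

theorem continuous_bump : Continuous (bump : V → ℝ) :=
  continuous_const.mul (contDiff_deriv_profile.continuous.comp (continuous_norm.pow 2))

theorem bump_nonneg (z : V) : 0 ≤ bump z := mul_nonneg zero_le_two (deriv_profile_nonneg _)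

theorem bump_neg (z : V) : bump (-z) = bump z := by simp [bump]

theorem bump_eq_zero {z : V} (hz : 1 ≤ ‖z‖) : bump z = 0 := by
  simp [bump, deriv_profile_eq_zero (one_le_pow₀ hz (n := 2))]

theorem bump_pos {z : V} (hz : ‖z‖ < 1) : 0 < bump z :=
  mul_pos two_pos (deriv_profile_pos (pow_lt_one₀ (norm_nonneg z) hz two_ne_zero))

theorem hasCompactSupport_bump [ProperSpace V] : HasCompactSupport (bump : V → ℝ) := by
  refine HasCompactSupport.intro (isCompact_closedBall 0 1) fun z hz => bump_eq_zero ?_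
  rw [mem_closedBall_zero_iff, not_le] at hz
  exact hz.le

variable [InnerProductSpace ℝ V] [FiniteDimensional ℝ V] [MeasurableSpace V] [BorelSpace V]

variable (V) in
/-- The total mass of the averaging kernel. -/
noncomputable def bumpMass : ℝ := ∫ z : V, bump z

theorem integrable_mul_bump {u : V → ℝ} (hu : Continuous u) :
    Integrable fun z => u z * bump z := by
  refine (hu.mul continuous_bump).integrable_of_hasCompactSupport ?_
  exact hasCompactSupport_bump.mul_left

theorem integrable_bump : Integrable (bump : V → ℝ) :=
  continuous_bump.integrable_of_hasCompactSupport hasCompactSupport_bump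

theorem bumpMass_pos : 0 < bumpMass V :=
  continuous_bump.integral_pos_of_hasCompactSupport_nonneg_nonzero hasCompactSupport_bump
    bump_nonneg (bump_pos (z := (0 : V)) (by simp)).ne'

theorem integral_comp_add_smul (u : V → ℝ) (x₀ : V) {t : ℝ} (ht : 0 < t) :
    ∫ z, u (x₀ + t • z) * bump z =
      ∫ y, u y * ((t ^ Module.finrank ℝ V)⁻¹ * (2 * deriv profile (‖y - x₀‖ ^ 2 / t ^ 2))) := by
  set F : V → ℝ := fun w => u (w + x₀) * bump (t⁻¹ • w) with hF
  have h1 : ∀ z : V, u (x₀ + t • z) * bump z = F (t • z) := fun z => by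
    simp [hF, smul_smul, inv_mul_cancel₀ ht.ne', add_comm]
  simp only [h1]
  rw [Measure.integral_comp_smul, ← integral_sub_right_eq_self _ x₀, smul_eq_mul,
    abs_of_pos (by positivity), ← integral_const_mul]
  refine integral_congr_ae (Filter.Eventually.of_forall fun y => ?_)
  simp only [hF, sub_add_cancel, bump, norm_smul, norm_inv, Real.norm_eq_abs, mul_pow, inv_pow, sq_abs]
  rw [div_eq_inv_mul]
  ring

theorem integral_comp_add_smul_of_closedBall_subset (u : V → ℝ) (x₀ : V) {t : ℝ} (ht : 0 < t)
    {K : Set V} (hK : Metric.closedBall x₀ t ⊆ K) :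
    ∫ z, u (x₀ + t • z) * bump z =
      ∫ y in K, u y * ((t ^ Module.finrank ℝ V)⁻¹ *
        (2 * deriv profile (‖y - x₀‖ ^ 2 / t ^ 2))) := by
  rw [integral_comp_add_smul u x₀ ht, setIntegral_eq_integral_of_forall_compl_eq_zero]
  intro y hy
  have h : t < ‖y - x₀‖ := by
    by_contra h
    exact hy (hK (by simpa [dist_eq_norm] using h))
  rw [deriv_profile_eq_zero]
  · simp
  · rw [one_le_div (by positivity)]
    gcongr

end Bump

/-! ### The mean value property of distributional solutions. -/

section MeanValue

theorem contDiff_scaled_profile (m : ℕ) (t : ℝ) :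
    ContDiff ℝ ∞ fun s => (t ^ m)⁻¹ * profile (s / t ^ 2) :=
  contDiff_const.mul (contDiff_profile.comp (contDiff_id.div_const _))

theorem hasDerivAt_profile (s : ℝ) : HasDerivAt profile (deriv profile s) s :=
  (contDiff_profile.differentiable (by simp) s).hasDerivAt

theorem hasDerivAt_deriv_profile (s : ℝ) :
    HasDerivAt (deriv profile) (deriv (deriv profile) s) s :=
  (contDiff_deriv_profile.differentiable (by simp) s).hasDerivAt

theorem continuous_deriv_deriv_profile : Continuous (deriv (deriv profile)) :=
  (contDiff_infty_iff_deriv.1 contDiff_deriv_profile).2.continuous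

theorem laplacian_scaled_profile {n : ℕ} (t : ℝ) (x₀ y : E n) :
    Laplacian.laplacian (fun y => (t ^ (n + 1))⁻¹ * profile (‖y - x₀‖ ^ 2 / t ^ 2)) y =
      (t ^ (n + 1))⁻¹ * (4 * ‖y - x₀‖ ^ 2 / t ^ 4 * deriv (deriv profile) (‖y - x₀‖ ^ 2 / t ^ 2) +
        2 * (n + 1) / t ^ 2 * deriv profile (‖y - x₀‖ ^ 2 / t ^ 2)) := by
  have h1 : deriv (fun s => (t ^ (n + 1))⁻¹ * profile (s / t ^ 2)) =
      fun s => (t ^ (n + 1))⁻¹ * (deriv profile (s / t ^ 2) * (1 / t ^ 2)) := funext fun s =>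
    (((hasDerivAt_profile _).comp s ((hasDerivAt_id s).div_const (t ^ 2))).const_mul _).deriv
  have h2 : deriv (fun s => (t ^ (n + 1))⁻¹ * (deriv profile (s / t ^ 2) * (1 / t ^ 2))) =
      fun s => (t ^ (n + 1))⁻¹ * (deriv (deriv profile) (s / t ^ 2) * (1 / t ^ 2) * (1 / t ^ 2)) :=
    funext fun s => ((((hasDerivAt_deriv_profile _).comp s
      ((hasDerivAt_id s).div_const (t ^ 2))).mul_const _).const_mul _).deriv
  rw [laplacian_comp_normSq (contDiff_scaled_profile (n + 1) t) x₀ y, h1, h2]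
  simp only [finrank_euclideanSpace, Fintype.card_fin]
  push_cast
  ring

theorem hasDerivAt_scaled_kernel (n : ℕ) {t : ℝ} (ht : 0 < t) (q : ℝ) :
    HasDerivAt (fun t : ℝ => (t ^ (n + 1))⁻¹ * (2 * deriv profile (q / t ^ 2)))
      (-(t * ((t ^ (n + 1))⁻¹ * (4 * q / t ^ 4 * deriv (deriv profile) (q / t ^ 2) +
        2 * (n + 1) / t ^ 2 * deriv profile (q / t ^ 2))))) t := by
  have h1 : HasDerivAt (fun x : ℝ => (x ^ (n + 1))⁻¹) _ t :=
    (hasDerivAt_pow (n + 1) t).inv (pow_pos ht (n + 1)).ne'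
  have h2 : HasDerivAt (fun t : ℝ => q / t ^ 2) (-(2 * q / t ^ 3)) t := by
    have := ((hasDerivAt_pow 2 t).inv (pow_pos ht 2).ne').const_mul q
    refine HasDerivAt.congr_deriv (f := fun t : ℝ => q / t ^ 2) this ?_
    field_simp
    ring
  have h3 := h1.mul (((hasDerivAt_deriv_profile (q / t ^ 2)).comp t h2).const_mul 2)
  refine HasDerivAt.congr_deriv (f := fun t : ℝ => (t ^ (n + 1))⁻¹ *
    (2 * deriv profile (q / t ^ 2))) h3 ?_
  simp only [Nat.add_sub_cancel, Function.comp_apply]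
  push_cast
  have h5 : t ^ n ≠ 0 := (pow_pos ht n).ne'
  simp only [pow_succ t n]
  field_simp
  ring

variable {n : ℕ}

/-- The kernel `bump`, rescaled to the ball of radius `t` centred at `x₀`. -/
noncomputable def scaledKernel (x₀ : E n) (t : ℝ) (y : E n) : ℝ :=
  (t ^ (n + 1))⁻¹ * (2 * deriv profile (‖y - x₀‖ ^ 2 / t ^ 2))

/-- A test function whose Laplacian is `-t⁻¹` times the `t`-derivative of `scaledKernel`. -/
noncomputable def scaledPotential (x₀ : E n) (t : ℝ) (y : E n) : ℝ :=
  (t ^ (n + 1))⁻¹ * profile (‖y - x₀‖ ^ 2 / t ^ 2)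

/-- Scaling gives `∂ₜ k = -t⁻¹ div (k · (y - x₀))` for the kernel `k`, and `k · (y - x₀)` is `t²`
times the gradient of `scaledPotential x₀ t`. This is what lets the weak equation control the
averages. -/
theorem hasDerivAt_scaledKernel (x₀ : E n) {t : ℝ} (ht : 0 < t) (y : E n) :
    HasDerivAt (fun t => scaledKernel x₀ t y)
      (-(t * Laplacian.laplacian (scaledPotential x₀ t) y)) t := by
  unfold scaledPotential
  rw [laplacian_scaled_profile]
  exact hasDerivAt_scaled_kernel n ht _

theorem continuous_scaledKernel (x₀ : E n) (t : ℝ) : Continuous (scaledKernel x₀ t) := by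
  have := contDiff_deriv_profile.continuous
  unfold scaledKernel
  fun_prop

theorem scaledKernel_nonneg (x₀ : E n) {t : ℝ} (ht : 0 < t) (y : E n) :
    0 ≤ scaledKernel x₀ t y := by
  have := deriv_profile_nonneg (‖y - x₀‖ ^ 2 / t ^ 2)
  unfold scaledKernel
  positivity

theorem scaledPotential_eq_zero (x₀ : E n) {t : ℝ} (ht : 0 < t) {y : E n}
    (hy : y ∉ Metric.ball x₀ t) : scaledPotential x₀ t y = 0 := by
  have h : t ≤ ‖y - x₀‖ := by simpa [dist_eq_norm] using hy
  unfold scaledPotential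
  rw [profile_eq_zero, mul_zero]
  rw [one_le_div (by positivity)]
  gcongr

theorem scaledKernel_eq_zero (x₀ : E n) {t : ℝ} (ht : 0 < t) {y : E n}
    (hy : y ∉ Metric.ball x₀ t) : scaledKernel x₀ t y = 0 := by
  have h : t ≤ ‖y - x₀‖ := by simpa [dist_eq_norm] using hy
  unfold scaledKernel
  rw [deriv_profile_eq_zero, mul_zero, mul_zero]
  rw [one_le_div (by positivity)]
  gcongr

theorem contDiff_scaledPotential (x₀ : E n) (t : ℝ) : ContDiff ℝ ∞ (scaledPotential x₀ t) :=
  (contDiff_scaled_profile (n + 1) t).comp ((contDiff_id.sub contDiff_const).norm_sq ℝ)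

theorem tsupport_scaledPotential_subset (x₀ : E n) {t : ℝ} (ht : 0 < t) :
    tsupport (scaledPotential x₀ t) ⊆ Metric.closedBall x₀ t := by
  refine closure_minimal (fun y hy => ?_) Metric.isClosed_closedBall
  by_contra h
  exact hy (scaledPotential_eq_zero x₀ ht fun h' => h (Metric.ball_subset_closedBall h'))

theorem abs_scaledPotential_le (x₀ : E n) {t : ℝ} (ht : 0 < t) (y : E n) :
    |scaledPotential x₀ t y| ≤ (Metric.ball x₀ t).indicator (fun _ => (t ^ (n + 1))⁻¹) y := by
  by_cases hy : y ∈ Metric.ball x₀ t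
  · rw [indicator_of_mem hy]
    unfold scaledPotential
    rw [abs_mul, abs_of_pos (by positivity : 0 < (t ^ (n + 1))⁻¹)]
    exact mul_le_of_le_one_right (by positivity) abs_profile_le_one
  · rw [indicator_of_notMem hy, scaledPotential_eq_zero x₀ ht hy, abs_zero]

theorem integral_ball_inv_pow (x₀ : E n) {t : ℝ} (ht : 0 < t) :
    ∫ y, (Metric.ball x₀ t).indicator (fun _ => (t ^ (n + 1))⁻¹) y =
      volume.real (Metric.ball (0 : E n) 1) := by
  rw [integral_indicator Metric.isOpen_ball.measurableSet, setIntegral_const,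
    measureReal_def, measureReal_def, Measure.addHaar_ball_of_pos _ _ ht, ENNReal.toReal_mul,
    ENNReal.toReal_ofReal (by positivity)]
  simp only [finrank_euclideanSpace, Fintype.card_fin, smul_eq_mul]
  field_simp

theorem integral_scaledKernel (x₀ : E n) {t : ℝ} (ht : 0 < t) {K : Set (E n)}
    (hK : Metric.closedBall x₀ t ⊆ K) (u : E n → ℝ) :
    ∫ y in K, u y * scaledKernel x₀ t y = ∫ z, u (x₀ + t • z) * bump z := by
  rw [integral_comp_add_smul_of_closedBall_subset u x₀ ht hK]
  simp [scaledKernel, finrank_euclideanSpace]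

/-- The integration domain is a fixed ball independent of `t`, so only the kernel is differentiated.
-/
theorem hasDerivAt_integral_scaledKernel {φ : E n → ℝ} {x₀ : E n} {s : ℝ}
    (hφ : ContinuousOn φ (Metric.closedBall x₀ s)) {t : ℝ} (ht : 0 < t) :
    HasDerivAt (fun t => ∫ y in Metric.closedBall x₀ s, φ y * scaledKernel x₀ t y)
      (-(t * ∫ y in Metric.closedBall x₀ s,
        φ y * Laplacian.laplacian (scaledPotential x₀ t) y)) t := by
  set K := Metric.closedBall x₀ s
  have hKc : IsCompact K := isCompact_closedBall x₀ s
  -- Keeping `t` in a compact interval away from `0` makes the derivative jointly continuous on a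
  -- compact set, hence dominated by a constant.
  have hcont : ContinuousOn (fun p : ℝ × E n =>
      φ p.2 * -(p.1 * Laplacian.laplacian (scaledPotential x₀ p.1) p.2))
      (Icc (t / 2) (2 * t) ×ˢ K) := by
    refine (hφ.comp continuousOn_snd fun p hp => hp.2).mul ?_
    unfold scaledPotential
    simp only [laplacian_scaled_profile]
    have hne : ∀ p ∈ Icc (t / 2) (2 * t) ×ˢ K, p.1 ≠ 0 := fun p hp => by
      have := hp.1.1
      linarith
    have c1 := contDiff_deriv_profile.continuous
    have c2 := continuous_deriv_deriv_profile
    have c3 : ContinuousOn (fun p : ℝ × E n => ‖p.2 - x₀‖ ^ 2 / p.1 ^ 2)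
        (Icc (t / 2) (2 * t) ×ˢ K) :=
      ContinuousOn.div (by fun_prop) (by fun_prop) fun p hp => pow_ne_zero 2 (hne p hp)
    have c4 := c1.comp_continuousOn c3
    have c5 := c2.comp_continuousOn c3
    refine (continuousOn_fst.mul (ContinuousOn.mul ?_ (((ContinuousOn.div ?_ ?_ ?_).mul c5).add
      ((ContinuousOn.div ?_ ?_ ?_).mul c4)))).neg
    · exact ContinuousOn.inv₀ (by fun_prop) fun p hp => pow_ne_zero _ (hne p hp)
    all_goals first | fun_prop | exact fun p hp => pow_ne_zero _ (hne p hp)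
  obtain ⟨A, hA⟩ := (isCompact_Icc.prod hKc).exists_bound_of_continuousOn hcont
  have hmeas : ∀ t, AEStronglyMeasurable (fun y => φ y * scaledKernel x₀ t y)
      (volume.restrict K) := fun t =>
    (hφ.mul (continuous_scaledKernel x₀ t).continuousOn).aestronglyMeasurable
      Metric.isClosed_closedBall.measurableSet
  have htmem : t ∈ Icc (t / 2) (2 * t) := ⟨by linarith, by linarith⟩
  have key := hasDerivAt_integral_of_dominated_loc_of_deriv_le (μ := volume.restrict K)
    (F := fun t y => φ y * scaledKernel x₀ t y)
    (F' := fun t y => φ y * -(t * Laplacian.laplacian (scaledPotential x₀ t) y))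
    (x₀ := t) (s := Icc (t / 2) (2 * t)) (bound := fun _ => A)
    (Icc_mem_nhds (by linarith) (by linarith)) (Filter.Eventually.of_forall hmeas)
    ((hφ.mul (continuous_scaledKernel x₀ t).continuousOn).integrableOn_compact hKc)
    ((hcont.comp (by fun_prop : ContinuousOn (fun y : E n => (t, y)) K)
      fun y hy => ⟨htmem, hy⟩).aestronglyMeasurable Metric.isClosed_closedBall.measurableSet)
    ((ae_restrict_iff' Metric.isClosed_closedBall.measurableSet).2
      (Filter.Eventually.of_forall fun y hy τ hτ => hA (τ, y) ⟨hτ, hy⟩))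
    (integrableOn_const hKc.measure_lt_top.ne)
    (Filter.Eventually.of_forall fun y τ hτ =>
      (hasDerivAt_scaledKernel x₀ (by have := hτ.1; linarith) y).const_mul (φ y))
  refine key.2.congr_deriv ?_
  rw [← neg_mul, ← integral_const_mul]
  congr 1
  ext y
  ring

theorem tendsto_integral_scaledKernel {φ : E n → ℝ} {x₀ : E n} {s : ℝ} (hs : 0 < s)
    (hφ : ContinuousOn φ (Metric.closedBall x₀ s)) :
    Filter.Tendsto (fun t => ∫ y in Metric.closedBall x₀ s, φ y * scaledKernel x₀ t y)
      (nhdsWithin 0 (Ioi 0)) (nhds (φ x₀ * bumpMass (E n))) := by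
  rw [Metric.tendsto_nhds]
  intro η hη
  have hm := bumpMass_pos (V := E n)
  have hx : ContinuousAt φ x₀ := hφ.continuousAt (Metric.closedBall_mem_nhds x₀ hs)
  obtain ⟨r, hr, hrφ⟩ := Metric.continuousAt_iff.1 hx (η / (2 * bumpMass (E n))) (by positivity)
  filter_upwards [Ioo_mem_nhdsGT (lt_min hr hs)] with t ht
  have ht0 : 0 < t := ht.1
  have hts : t < s := ht.2.trans_le (min_le_right _ _)
  have htr : t < r := ht.2.trans_le (min_le_left _ _)
  set K := Metric.closedBall x₀ s
  have hK : Metric.closedBall x₀ t ⊆ K := Metric.closedBall_subset_closedBall hts.le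
  have hmass : ∫ y in K, scaledKernel x₀ t y = bumpMass (E n) := by
    simpa [bumpMass] using integral_scaledKernel x₀ ht0 hK fun _ => 1
  have hint : IntegrableOn (scaledKernel x₀ t) K :=
    (continuous_scaledKernel x₀ t).continuousOn.integrableOn_compact (isCompact_closedBall _ _)
  have hint2 : IntegrableOn (fun y => φ y * scaledKernel x₀ t y) K :=
    (hφ.mul (continuous_scaledKernel x₀ t).continuousOn).integrableOn_compact
      (isCompact_closedBall _ _)
  have heq : (∫ y in K, φ y * scaledKernel x₀ t y) - φ x₀ * bumpMass (E n) =
      ∫ y in K, (φ y - φ x₀) * scaledKernel x₀ t y := by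
    rw [← hmass, ← integral_const_mul, ← integral_sub hint2 (hint.const_mul _)]
    congr 1
    ext y
    ring
  rw [Real.dist_eq, heq, ← Real.norm_eq_abs]
  have hle : ‖∫ y in K, (φ y - φ x₀) * scaledKernel x₀ t y‖ ≤
      ∫ y in K, η / (2 * bumpMass (E n)) * scaledKernel x₀ t y := by
    refine norm_integral_le_of_norm_le (hint.const_mul _) (Filter.Eventually.of_forall fun y => ?_)
    by_cases hy : y ∈ Metric.ball x₀ t
    · rw [norm_mul, Real.norm_of_nonneg (scaledKernel_nonneg x₀ ht0 y)]
      refine mul_le_mul_of_nonneg_right ?_ (scaledKernel_nonneg x₀ ht0 y)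
      exact (hrφ ((Metric.mem_ball.1 hy).trans htr)).le
    · simp [scaledKernel_eq_zero x₀ ht0 hy]
  refine hle.trans_lt ?_
  rw [integral_const_mul, hmass]
  have : η / (2 * bumpMass (E n)) * bumpMass (E n) = η / 2 := by field_simp
  linarith

/-- Approximate mean value property of a distributional solution of `-Δφ = f`, `|f| ≤ F`. -/
theorem abs_average_sub_le {U : Set (E n)} {φ f : E n → ℝ} {F : ℝ} (hF : 0 ≤ F)
    (hφ : ContinuousOn φ U) (hf : ∀ᵐ x ∂volume.restrict U, |f x| ≤ F)
    (h : SolvesPoisson U φ f) {x₀ : E n} {s : ℝ} (hs : 0 < s)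
    (hsU : Metric.closedBall x₀ s ⊆ U) :
    |(∫ z, φ (x₀ + s • z) * bump z) - φ x₀ * bumpMass (E n)| ≤
      s ^ 2 * (F * volume.real (Metric.ball (0 : E n) 1)) := by
  set K := Metric.closedBall x₀ s
  set m := volume.real (Metric.ball (0 : E n) 1)
  have hm : 0 ≤ m := measureReal_nonneg
  have hφK : ContinuousOn φ K := hφ.mono hsU
  -- The weak equation turns the integral against the Laplacian into one of `f` against the
  -- potential, whose `L¹` norm is at most `m` at every scale.
  have hbound : ∀ t ∈ Ioc 0 s, ‖-(t * ∫ y in K,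
      φ y * Laplacian.laplacian (scaledPotential x₀ t) y)‖ ≤ s * (F * m) := by
    intro t ht
    have htK : Metric.closedBall x₀ t ⊆ K := Metric.closedBall_subset_closedBall ht.2
    have hsupp := tsupport_scaledPotential_subset x₀ ht.1
    have hcs : HasCompactSupport (scaledPotential x₀ t) :=
      (isCompact_closedBall x₀ t).of_isClosed_subset (isClosed_tsupport _) hsupp
    have h1 := h (scaledPotential x₀ t) (contDiff_scaledPotential x₀ t) hcs
      (hsupp.trans (htK.trans hsU))
    have hL : ∀ y ∉ Metric.closedBall x₀ t,
        Laplacian.laplacian (scaledPotential x₀ t) y = 0 := fun y hy => by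
      have hev : scaledPotential x₀ t =ᶠ[nhds y] fun _ => 0 :=
        notMem_tsupport_iff_eventuallyEq.1 fun h => hy (hsupp h)
      have := (InnerProductSpace.laplacian_congr_nhds hev).eq_of_nhds
      simpa using this
    have h2 : ∫ y in K, φ y * Laplacian.laplacian (scaledPotential x₀ t) y =
        ∫ y in U, φ y * Laplacian.laplacian (scaledPotential x₀ t) y := by
      rw [setIntegral_eq_integral_of_forall_compl_eq_zero,
        setIntegral_eq_integral_of_forall_compl_eq_zero]
      · exact fun y hy => by rw [hL y fun h => hy (hsU (htK h)), mul_zero]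
      · exact fun y hy => by rw [hL y fun h => hy (htK h), mul_zero]
    have h3 : ‖∫ y in U, f y * scaledPotential x₀ t y‖ ≤ F * m := by
      set g : E n → ℝ := (Metric.ball x₀ t).indicator (fun _ => (t ^ (n + 1))⁻¹) with hg
      have hgi : Integrable g :=
        (integrableOn_const (μ := volume) (C := (t ^ (n + 1))⁻¹)
          Metric.isBounded_ball.measure_lt_top.ne).integrable_indicator
          Metric.isOpen_ball.measurableSet
      have hg0 : 0 ≤ g := fun y => indicator_nonneg (fun _ _ => by
        have := ht.1
        positivity) y
      calc _ ≤ ∫ y in U, F * g y := by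
            refine norm_integral_le_of_norm_le (hgi.integrableOn.const_mul F) ?_
            filter_upwards [hf] with y hy
            rw [norm_mul, Real.norm_eq_abs, Real.norm_eq_abs]
            exact mul_le_mul hy (abs_scaledPotential_le x₀ ht.1 y) (abs_nonneg _) hF
        _ ≤ ∫ y, F * g y := setIntegral_le_integral (hgi.const_mul F)
            (Filter.Eventually.of_forall fun y => mul_nonneg hF (hg0 y))
        _ = F * m := by rw [integral_const_mul, hg, integral_ball_inv_pow x₀ ht.1]
    rw [norm_neg, norm_mul, Real.norm_of_nonneg ht.1.le, h2, ← norm_neg (∫ y in U, _), h1]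
    exact mul_le_mul ht.2 h3 (norm_nonneg _) hs.le
  have hincr : ∀ t ∈ Ioc 0 s, |(∫ y in K, φ y * scaledKernel x₀ s y) -
      ∫ y in K, φ y * scaledKernel x₀ t y| ≤ s ^ 2 * (F * m) := by
    intro t ht
    have := norm_image_sub_le_of_norm_deriv_le_segment'
      (f := fun t => ∫ y in K, φ y * scaledKernel x₀ t y) (a := t) (b := s)
      (fun τ hτ => (hasDerivAt_integral_scaledKernel hφK
        (ht.1.trans_le hτ.1)).hasDerivWithinAt)
      (fun τ hτ => hbound τ ⟨ht.1.trans_le hτ.1, hτ.2.le⟩) s ⟨ht.2, le_rfl⟩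
    rw [Real.norm_eq_abs] at this
    refine this.trans ?_
    have h4 : 0 ≤ s * (F * m) := by positivity
    nlinarith [ht.1]
  -- The increment bound is uniform in `t`, so it survives the limit `t → 0⁺`.
  rw [← integral_scaledKernel x₀ hs (K := K) subset_rfl]
  refine le_of_tendsto ((tendsto_const_nhds.sub (tendsto_integral_scaledKernel hs hφK)).abs) ?_
  filter_upwards [Ioc_mem_nhdsGT hs] with t ht using hincr t ht

end MeanValue

/-! ### Averages of polynomials and of affine modifications of a solution. -/

variable {n : ℕ}

theorem continuous_lastCoord : Continuous (lastCoord : E n → ℝ) := by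
  unfold lastCoord
  fun_prop

theorem lastCoord_add (x y : E n) : lastCoord (x + y) = lastCoord x + lastCoord y := rfl

theorem lastCoord_smul (s : ℝ) (x : E n) : lastCoord (s • x) = s * lastCoord x := rfl

theorem lastCoord_neg (x : E n) : lastCoord (-x) = -lastCoord x := rfl

theorem abs_lastCoord_le (x : E n) : |lastCoord x| ≤ ‖x‖ := by
  simpa [lastCoord] using PiLp.norm_apply_le x (Fin.last n)

theorem add_smul_mem_closedBall {x₀ z : E n} {s : ℝ} (hs : 0 < s) (hz : ‖z‖ ≤ 1) :
    x₀ + s • z ∈ Metric.closedBall x₀ s := by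
  rw [mem_closedBall_iff_norm, add_sub_cancel_left, norm_smul, Real.norm_of_nonneg hs.le]
  exact mul_le_of_le_one_right hs.le hz

theorem integrable_comp_mul_bump {u : E n → ℝ} {x₀ : E n} {s : ℝ} (hs : 0 < s)
    (hu : ContinuousOn u (Metric.closedBall x₀ s)) :
    Integrable fun z => u (x₀ + s • z) * bump z := by
  have h1 : ContinuousOn (fun z => u (x₀ + s • z) * bump z) (Metric.closedBall (0 : E n) 1) :=
    (hu.comp (by fun_prop) fun z hz => add_smul_mem_closedBall hs (by simpa using hz)).mul
      continuous_bump.continuousOn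
  refine (h1.integrableOn_compact (isCompact_closedBall _ _)).integrable_of_forall_notMem_eq_zero
    fun z hz => ?_
  rw [mem_closedBall_zero_iff, not_le] at hz
  rw [bump_eq_zero hz.le, mul_zero]

theorem integral_odd_mul_bump {ℓ : E n → ℝ} (hℓ : ∀ z, ℓ (-z) = -ℓ z) :
    ∫ z, ℓ z * bump z = 0 := by
  have h := integral_neg_eq_self (fun z : E n => ℓ z * bump z) volume
  simp only [hℓ, bump_neg, neg_mul, integral_neg] at h
  linarith

/-- The kernel is even, so the odd first-order term integrates to zero. -/
theorem average_quadratic {u ℓ Q : E n → ℝ} {x₀ : E n} {s : ℝ} (hℓc : Continuous ℓ)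
    (hQc : Continuous Q) (hℓ : ∀ z, ℓ (-z) = -ℓ z)
    (hu : ∀ z, u (x₀ + s • z) = u x₀ + s * ℓ z + s ^ 2 * Q z) :
    ∫ z, u (x₀ + s • z) * bump z = u x₀ * bumpMass (E n) + s ^ 2 * ∫ z, Q z * bump z := by
  have h1 : ∀ z, u (x₀ + s • z) * bump z =
      u x₀ * bump z + s * (ℓ z * bump z) + s ^ 2 * (Q z * bump z) := fun z => by
    rw [hu]
    ring
  simp only [h1]
  have hi1 := (integrable_bump (V := E n)).const_mul (u x₀)
  have hi2 := (integrable_mul_bump hℓc).const_mul s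
  have hi3 := (integrable_mul_bump hQc).const_mul (s ^ 2)
  rw [integral_add (f := fun z => u x₀ * bump z + s * (ℓ z * bump z)) (hi1.add hi2) hi3,
    integral_add hi1 hi2]
  simp only [integral_const_mul, integral_odd_mul_bump hℓ, bumpMass]
  ring

theorem average_affine (β d : ℝ) (x₀ : E n) (s : ℝ) :
    ∫ z, (β * lastCoord (x₀ + s • z) + d) * bump z =
      (β * lastCoord x₀ + d) * bumpMass (E n) := by
  have := average_quadratic (u := fun x : E n => β * lastCoord x + d)
    (ℓ := fun z => β * lastCoord z) (Q := fun _ => 0) (x₀ := x₀) (s := s)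
    (continuous_const.mul continuous_lastCoord) continuous_const
    (fun z => by rw [lastCoord_neg]; ring)
    (fun z => by rw [lastCoord_add, lastCoord_smul]; ring)
  simpa using this

theorem abs_average_sub_le_of_affine {U : Set (E n)} {φ f w : E n → ℝ} {F c β d : ℝ} (hF : 0 ≤ F)
    (hφ : ContinuousOn φ U) (hf : ∀ᵐ x ∂volume.restrict U, |f x| ≤ F)
    (h : SolvesPoisson U φ f) (hw : ∀ x, w x = c * φ x + (β * lastCoord x + d))
    {x₀ : E n} {s : ℝ} (hs : 0 < s) (hsU : Metric.closedBall x₀ s ⊆ U) :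
    |(∫ z, w (x₀ + s • z) * bump z) - w x₀ * bumpMass (E n)| ≤
      s ^ 2 * (|c| * F * volume.real (Metric.ball (0 : E n) 1)) := by
  have h1 : ∀ z, w (x₀ + s • z) * bump z = c * (φ (x₀ + s • z) * bump z) +
      (β * lastCoord (x₀ + s • z) + d) * bump z := fun z => by
    rw [hw]
    ring
  have hi1 := (integrable_comp_mul_bump hs (hφ.mono hsU)).const_mul c
  have hi2 : Integrable fun z => (β * lastCoord (x₀ + s • z) + d) * bump z :=
    integrable_comp_mul_bump (u := fun x : E n => β * lastCoord x + d) hs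
      ((continuous_const.mul continuous_lastCoord).add continuous_const).continuousOn
  simp only [h1]
  rw [integral_add hi1 hi2, integral_const_mul, average_affine, hw]
  have h2 := abs_average_sub_le hF hφ hf h hs hsU
  have h3 : ∀ I : ℝ, c * I + (β * lastCoord x₀ + d) * bumpMass (E n) -
      (c * φ x₀ + (β * lastCoord x₀ + d)) * bumpMass (E n) =
      c * (I - φ x₀ * bumpMass (E n)) := fun I => by ring
  rw [h3, abs_mul]
  calc _ ≤ |c| * (s ^ 2 * (F * volume.real (Metric.ball (0 : E n) 1))) :=
        mul_le_mul_of_nonneg_left h2 (abs_nonneg c)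
    _ = _ := by ring

/-! ### The quadratic barrier and the comparison principle. -/

section Barrier

/-- Second moment of the averaging kernel in the last direction. -/
noncomputable def lastMoment (n : ℕ) : ℝ := ∫ z : E n, lastCoord z ^ 2 * bump z

/-- Full second moment of the averaging kernel. -/
noncomputable def normMoment (n : ℕ) : ℝ := ∫ z : E n, ‖z‖ ^ 2 * bump z

theorem lastMoment_pos (n : ℕ) : 0 < lastMoment n := by
  have hc : Continuous fun z : E n => lastCoord z ^ 2 * bump z :=
    (continuous_lastCoord.pow 2).mul continuous_bump
  refine hc.integral_pos_of_hasCompactSupport_nonneg_nonzero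
    hasCompactSupport_bump.mul_left (fun z => mul_nonneg (sq_nonneg _) (bump_nonneg z))
    (x := EuclideanSpace.single (Fin.last n) (1 / 2 : ℝ)) ?_
  have h1 : lastCoord (EuclideanSpace.single (Fin.last n) (1 / 2 : ℝ)) = 1 / 2 := by
    simp [lastCoord]
  have h2 : 0 < bump (EuclideanSpace.single (Fin.last n) (1 / 2 : ℝ)) := bump_pos (by
    rw [PiLp.norm_single]
    norm_num)
  rw [h1]
  positivity

theorem normMoment_nonneg (n : ℕ) : 0 ≤ normMoment n :=
  integral_nonneg fun z => mul_nonneg (sq_nonneg _) (bump_nonneg z)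

/-- The second-order coefficient of the barrier in the last direction. -/
noncomputable def barrierCoeff (n : ℕ) : ℝ := (64 * normMoment n + 1) / lastMoment n

theorem barrierCoeff_pos (n : ℕ) : 0 < barrierCoeff n :=
  div_pos (by linarith [normMoment_nonneg n]) (lastMoment_pos n)

/-- A quadratic subsolution, nonpositive on the lateral boundary `‖x‖ = 1/8` and on the top
`x_d + b = 1 / (1 + barrierCoeff n)` of the slab it is used in. -/
noncomputable def barrier (b κ : ℝ) (x : E n) : ℝ :=
  κ * (1 - 64 * ‖x‖ ^ 2 + barrierCoeff n * (lastCoord x + b) ^ 2 -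
    2 * (1 + barrierCoeff n) * (lastCoord x + b))

theorem continuous_barrier (b κ : ℝ) : Continuous (barrier b κ : E n → ℝ) := by
  have := continuous_lastCoord (n := n)
  unfold barrier
  fun_prop

/-- `barrierCoeff n` is the solution `A` of `A * lastMoment n - 64 * normMoment n = 1`, so the
second-order term contributes exactly `s² κ`. -/
theorem average_barrier (b κ : ℝ) (x₀ : E n) (s : ℝ) :
    ∫ z, barrier b κ (x₀ + s • z) * bump z =
      barrier b κ x₀ * bumpMass (E n) + s ^ 2 * κ := by
  set A := barrierCoeff n with hA
  have hlc := continuous_lastCoord (n := n)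
  have h := average_quadratic (u := barrier b κ) (x₀ := x₀) (s := s)
    (ℓ := fun z => κ * (-128 * inner ℝ x₀ z + 2 * A * (lastCoord x₀ + b) * lastCoord z -
      2 * (1 + A) * lastCoord z))
    (Q := fun z => κ * (A * lastCoord z ^ 2 - 64 * ‖z‖ ^ 2))
    (by fun_prop) (by fun_prop)
    (fun z => by simp only [lastCoord_neg, inner_neg_right]; ring)
    (fun z => by
      simp only [barrier, lastCoord_add, lastCoord_smul, ← hA]
      rw [norm_add_sq_real, inner_smul_right, norm_smul, mul_pow, Real.norm_eq_abs, sq_abs]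
      ring)
  rw [h]
  congr 2
  have h1 : ∀ z : E n, κ * (A * lastCoord z ^ 2 - 64 * ‖z‖ ^ 2) * bump z =
      κ * A * (lastCoord z ^ 2 * bump z) - κ * 64 * (‖z‖ ^ 2 * bump z) := fun z => by ring
  simp only [h1]
  rw [integral_sub ((integrable_mul_bump (by fun_prop)).const_mul _)
    ((integrable_mul_bump (by fun_prop)).const_mul _), integral_const_mul, integral_const_mul]
  change κ * A * lastMoment n - κ * 64 * normMoment n = κ
  have h2 : A * lastMoment n = 64 * normMoment n + 1 := by
    rw [hA, barrierCoeff]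
    field_simp [(lastMoment_pos n).ne']
  linear_combination κ * h2

/-- The slab in which the barrier is compared with a supersolution. -/
def slab (n : ℕ) (b : ℝ) : Set (E n) :=
  {x | ‖x‖ ≤ 1 / 8 ∧ 0 ≤ lastCoord x + b ∧ lastCoord x + b ≤ 1 / (1 + barrierCoeff n)}

theorem isCompact_slab (b : ℝ) : IsCompact (slab n b) := by
  have hlc := continuous_lastCoord (n := n)
  refine (isCompact_closedBall (0 : E n) (1 / 8)).of_isClosed_subset ?_ fun x hx => ?_
  · have h1 : IsClosed {x : E n | ‖x‖ ≤ 1 / 8} := isClosed_le (by fun_prop) (by fun_prop)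
    have h2 : IsClosed {x : E n | 0 ≤ lastCoord x + b} := isClosed_le (by fun_prop) (by fun_prop)
    have h3 : IsClosed {x : E n | lastCoord x + b ≤ 1 / (1 + barrierCoeff n)} :=
      isClosed_le (by fun_prop) (by fun_prop)
    exact h1.inter (h2.inter h3)
  · simpa using hx.1

/-- A negative minimum of `w - barrier` cannot lie on the lateral side or the top, where the barrier
is nonpositive, nor where `w ≥ κ`, since the barrier never exceeds `κ` on the slab. At an interior
minimum inside `Ω`, the average of the difference exceeds its centre value by at most `s² (A - κ) <
0`, which minimality forbids. -/
theorem barrier_le {w : E n → ℝ} {Ω : Set (E n)} {b κ A : ℝ} (hκ : 0 < κ)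
    (hw : ContinuousOn w (Metric.closedBall 0 (1 / 8))) (hpos : ∀ x ∈ slab n b, 0 ≤ w x)
    (hΩ : IsOpen Ω) (hbd : ∀ x ∈ slab n b, w x < κ → x ∈ Ω ∧ 0 < lastCoord x + b)
    (hmv : ∀ x s, 0 < s → Metric.closedBall x s ⊆ Ω →
      |(∫ z, w (x + s • z) * bump z) - w x * bumpMass (E n)| ≤ s ^ 2 * A)
    (hA : A < κ) : ∀ x ∈ slab n b, barrier b κ x ≤ w x := by
  intro x hx
  have hsub : slab n b ⊆ Metric.closedBall 0 (1 / 8) := fun y hy => by simpa using hy.1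
  obtain ⟨x₀, hx₀, hmin⟩ := (isCompact_slab b).exists_isMinOn ⟨x, hx⟩
    ((hw.mono hsub).sub (continuous_barrier b κ).continuousOn)
  by_contra hlt
  have hneg : w x₀ - barrier b κ x₀ < 0 := lt_of_le_of_lt (hmin hx) (by simpa using hlt)
  have hvpos : 0 < barrier b κ x₀ := by linarith [hpos x₀ hx₀]
  have hlc := continuous_lastCoord (n := n)
  have hKp := barrierCoeff_pos n
  obtain ⟨hn, ht0, htτ⟩ := hx₀
  set K := barrierCoeff n with hK
  set t := lastCoord x₀ + b with ht
  have htK : t * (1 + K) ≤ 1 := (le_div_iff₀ (by positivity)).1 htτ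
  have hbr : 0 < 1 - 64 * ‖x₀‖ ^ 2 + K * t ^ 2 - 2 * (1 + K) * t := by
    unfold barrier at hvpos
    exact (mul_pos_iff_of_pos_left hκ).1 hvpos
  -- This bounds the bracket by `1 - 64‖x₀‖² - (1 + K) t`, from which the exclusion of the side and
  -- the top and the bound by `κ` all follow.
  have hKt : K * t ^ 2 ≤ (1 + K) * t := by nlinarith
  have hn' : ‖x₀‖ < 1 / 8 := by
    by_contra hge
    have h8 : ‖x₀‖ = 1 / 8 := le_antisymm hn (not_lt.1 hge)
    rw [h8] at hbr
    nlinarith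
  have htτ' : t < 1 / (1 + K) := by
    rw [lt_div_iff₀ (by positivity)]
    nlinarith [sq_nonneg ‖x₀‖]
  have hwκ : w x₀ < κ := by
    have hle : barrier b κ x₀ ≤ κ := by
      unfold barrier
      refine mul_le_of_le_one_right hκ.le ?_
      nlinarith [sq_nonneg ‖x₀‖]
    linarith
  obtain ⟨hxΩ, htpos⟩ := hbd x₀ ⟨hn, ht0, htτ⟩ hwκ
  set W : Set (E n) := Ω ∩ ({y | ‖y‖ < 1 / 8} ∩
    ({y | 0 < lastCoord y + b} ∩ {y | lastCoord y + b < 1 / (1 + K)})) with hW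
  have hWo : IsOpen W := hΩ.inter ((isOpen_lt (by fun_prop) (by fun_prop)).inter
    ((isOpen_lt (by fun_prop) (by fun_prop)).inter (isOpen_lt (by fun_prop) (by fun_prop))))
  obtain ⟨s, hs, hsW⟩ := Metric.nhds_basis_closedBall.mem_iff.1
    (hWo.mem_nhds (show x₀ ∈ W from ⟨hxΩ, hn', htpos, htτ'⟩))
  have hWs : W ⊆ slab n b := fun y hy => ⟨hy.2.1.le, hy.2.2.1.le, hy.2.2.2.le⟩
  have h1 := hmv x₀ s hs fun y hy => (hsW hy).1
  have h2 := average_barrier b κ x₀ s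
  have hi1 := integrable_comp_mul_bump hs (hw.mono ((hsW.trans hWs).trans hsub))
  have hi2 := integrable_comp_mul_bump (x₀ := x₀) hs (continuous_barrier b κ).continuousOn
  -- Minimality at `x₀`, integrated against the kernel.
  have h3 : (w x₀ - barrier b κ x₀) * bumpMass (E n) ≤
      (∫ z, w (x₀ + s • z) * bump z) - ∫ z, barrier b κ (x₀ + s • z) * bump z := by
    rw [← integral_sub hi1 hi2, bumpMass, ← integral_const_mul]
    refine integral_mono (integrable_bump.const_mul _) (hi1.sub hi2) fun z => ?_
    by_cases hz : ‖z‖ ≤ 1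
    · have := hmin (hWs (hsW (add_smul_mem_closedBall (x₀ := x₀) hs hz)))
      have hb := bump_nonneg z
      simp only [mem_ofPred_eq] at this
      simp only [← sub_mul]
      exact mul_le_mul_of_nonneg_right this hb
    · simp [bump_eq_zero (not_le.1 hz).le]
  rw [h2] at h3
  have h4 := (abs_le.1 h1).2
  have h5 : s ^ 2 * A < s ^ 2 * κ := mul_lt_mul_of_pos_left hA (by positivity)
  nlinarith

theorem half_le_barrier {b κ : ℝ} (hκ : 0 < κ) {x : E n}
    (hx : ‖x‖ ≤ 1 / (32 * (1 + barrierCoeff n)))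
    (ht : lastCoord x + b ≤ 1 / (8 * (1 + barrierCoeff n))) :
    κ / 2 ≤ barrier b κ x := by
  have hKp := barrierCoeff_pos n
  unfold barrier
  set K := barrierCoeff n
  have h1 : ‖x‖ ≤ 1 / 32 := hx.trans (by
    apply one_div_le_one_div_of_le <;> linarith)
  have h2 : (lastCoord x + b) * (8 * (1 + K)) ≤ 1 := (le_div_iff₀ (by positivity)).1 ht
  have h3 : ‖x‖ ^ 2 ≤ 1 / 1024 := by nlinarith [norm_nonneg x]
  have h4 : 0 ≤ K * (lastCoord x + b) ^ 2 := by positivity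
  rw [div_eq_mul_inv]
  refine mul_le_mul_of_nonneg_left ?_ hκ.le
  linarith

end Barrier

/-! ### Interior oscillation estimate. -/

section Oscillation

/-- Moving the centre is the same as translating the kernel, which is uniformly continuous. The
budget is `m/8` for the translation and `m/16` for each of the two mean value errors, in total `m/4`
times `ε`. -/
theorem exists_oscillation_radius (n : ℕ) {r : ℝ} (hr : 0 < r) (hr1 : r ≤ 1) :
    ∃ ρ, 0 < ρ ∧ ρ ≤ r / 4 ∧ ∀ (w : E n → ℝ) (ε : ℝ), 0 < ε →
      ContinuousOn w (Metric.ball 0 r) → (∀ x ∈ Metric.ball 0 r, 0 ≤ w x ∧ w x ≤ ε) →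
      (∀ x s, 0 < s → Metric.closedBall x s ⊆ Metric.ball 0 r →
        |(∫ z, w (x + s • z) * bump z) - w x * bumpMass (E n)| ≤
          s ^ 2 * (bumpMass (E n) / 16 * ε)) →
      ∀ x ∈ Metric.ball 0 ρ, |w x - w 0| ≤ ε / 4 := by
  have hm := bumpMass_pos (V := E n)
  set m := bumpMass (E n)
  set M := volume.real (Metric.ball (0 : E n) 2)
  have hM : 0 ≤ M := measureReal_nonneg
  obtain ⟨h₀, hh₀, huc⟩ := Metric.uniformContinuous_iff.1
    (hasCompactSupport_bump.uniformContinuous_of_continuous (continuous_bump (V := E n)))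
    (m / (8 * (M + 1))) (by positivity)
  set s := r / 4 with hs_def
  have hs : 0 < s := by positivity
  refine ⟨s * min h₀ 1, by positivity, mul_le_of_le_one_right hs.le (min_le_right _ _), ?_⟩
  intro w ε hε hw hwε hmv x hx
  rw [mem_ball_zero_iff] at hx
  set h := s⁻¹ • x with hh
  have hnh : ‖h‖ < min h₀ 1 := by
    rw [hh, norm_smul, norm_inv, Real.norm_of_nonneg hs.le, inv_mul_lt_iff₀ hs]
    exact hx
  have hsx : x = s • h := by rw [hh, smul_inv_smul₀ hs.ne']
  have hh1 : ‖h‖ < 1 := hnh.trans_le (min_le_right _ _)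
  have hxs : ‖x‖ < s := hx.trans_le (mul_le_of_le_one_right hs.le (min_le_right _ _))
  have hb0 : Metric.closedBall (0 : E n) s ⊆ Metric.ball 0 r :=
    Metric.closedBall_subset_ball (by linarith)
  have hbx : Metric.closedBall x s ⊆ Metric.ball 0 r := fun y hy => by
    rw [mem_closedBall_iff_norm] at hy
    rw [mem_ball_zero_iff]
    have := norm_le_norm_add_norm_sub' y x
    linarith
  have h1 := hmv 0 s hs hb0
  have h2 := hmv x s hs hbx
  have hi1 := integrable_comp_mul_bump hs (hw.mono hb0)
  have hi2 := integrable_comp_mul_bump hs (hw.mono hbx)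
  have hshift : ∀ z, w (x + s • z) * bump z =
      (fun z => w (0 + s • z) * bump (z - h)) (z + h) := fun z => by
    simp [hsx, smul_add, add_comm]
  have hi3 : Integrable fun z => w (0 + s • z) * bump (z - h) := by
    have := hi2.comp_sub_right h
    simpa [hshift] using this
  have heq : ∫ z, w (x + s • z) * bump z = ∫ z, w (0 + s • z) * bump (z - h) := by
    simp only [hshift]
    exact integral_add_right_eq_self (fun z => w (0 + s • z) * bump (z - h)) h
  have hdiff : |(∫ z, w (x + s • z) * bump z) - ∫ z, w (0 + s • z) * bump z| ≤ ε * (m / 8) := by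
    rw [heq, ← integral_sub hi3 hi1, ← Real.norm_eq_abs]
    calc _ ≤ ∫ z, (Metric.ball (0 : E n) 2).indicator (fun _ => ε * (m / (8 * (M + 1)))) z := by
          refine norm_integral_le_of_norm_le ?_ (Filter.Eventually.of_forall fun z => ?_)
          · exact (integrableOn_const (μ := volume) Metric.isBounded_ball.measure_lt_top.ne)
              |>.integrable_indicator Metric.isOpen_ball.measurableSet
          · by_cases hz : z ∈ Metric.ball (0 : E n) 2
            · rw [indicator_of_mem hz, ← mul_sub, norm_mul]
              have hz2 : ‖z‖ < 2 := by simpa using hz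
              have hmem : (0 : E n) + s • z ∈ Metric.ball 0 r := by
                rw [zero_add, mem_ball_zero_iff, norm_smul, Real.norm_of_nonneg hs.le]
                nlinarith
              obtain ⟨ha, hb⟩ := hwε _ hmem
              have hd : dist (z - h) z < h₀ := by
                rw [dist_eq_norm]
                simpa using hnh.trans_le (min_le_left _ _)
              have := (huc hd).le
              rw [dist_eq_norm] at this
              rw [Real.norm_of_nonneg ha]
              exact mul_le_mul hb this (norm_nonneg _) hε.le
            -- Both kernels vanish here because `‖h‖ < 1`.
            · have hz2 : 2 ≤ ‖z‖ := by simpa using hz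
              have hz3 : 1 ≤ ‖z - h‖ := by
                have := norm_sub_norm_le z h
                linarith
              rw [indicator_of_notMem hz, bump_eq_zero hz3, bump_eq_zero (by linarith)]
              simp
      _ = M * (ε * (m / (8 * (M + 1)))) := by
          rw [integral_indicator Metric.isOpen_ball.measurableSet, setIntegral_const, smul_eq_mul]
      _ ≤ ε * (m / 8) := by
          have : M * (ε * (m / (8 * (M + 1)))) = ε * (m / 8) * (M / (M + 1)) := by
            field_simp
          rw [this]
          exact mul_le_of_le_one_right (by positivity)
            ((div_le_one (by positivity)).2 (by linarith))
  have hs2 : s ^ 2 * (m / 16 * ε) ≤ m / 16 * ε :=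
    mul_le_of_le_one_left (by positivity) (pow_le_one₀ hs.le (by linarith))
  have hfin : |w x - w 0| * m ≤ ε / 4 * m := by
    rw [← abs_of_pos hm, ← abs_mul, abs_of_pos hm]
    rw [abs_le] at *
    constructor <;> nlinarith
  exact le_of_mul_le_mul_right hfin hm

end Oscillation

/-! ### Application of the barrier to `φ` near the free boundary. -/

theorem mem_B {r : ℝ} {x : E n} : x ∈ B n r ↔ ‖x‖ < r := mem_ball_zero_iff

theorem isOpen_positivitySet {φ : E n → ℝ} (hφ : ContinuousOn φ (B n 1)) :
    IsOpen (positivitySet φ) :=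
  hφ.isOpen_inter_preimage Metric.isOpen_ball isOpen_Ioi

theorem ae_abs_le_of_eLpNorm_top_le {X : Type*} [MeasurableSpace X] {μ : Measure X} {f : X → ℝ}
    {F : ℝ} (hF : 0 ≤ F) (h : eLpNorm f ∞ μ ≤ ENNReal.ofReal F) : ∀ᵐ x ∂μ, |f x| ≤ F := by
  rw [eLpNorm_exponent_top] at h
  filter_upwards [ae_le_eLpNormEssSup (f := f) (μ := μ)] with x hx
  have := hx.trans h
  rw [← ofReal_norm, ENNReal.ofReal_le_ofReal_iff hF, Real.norm_eq_abs] at this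
  exact this

/-- The length scale on which the barrier controls a neighbourhood of the origin. -/
noncomputable def barrierScale (n : ℕ) : ℝ := 1 / (32 * (1 + barrierCoeff n))

theorem barrierScale_pos (n : ℕ) : 0 < barrierScale n := by
  have := barrierCoeff_pos n
  unfold barrierScale
  positivity

theorem barrierScale_le (n : ℕ) : barrierScale n ≤ 1 / 32 := by
  have := barrierCoeff_pos n
  exact one_div_le_one_div_of_le (by norm_num) (by linarith)

/-- The barrier comparison, read off near the origin. -/
theorem half_le_of_comparison {w : E n → ℝ} {Ω : Set (E n)} {b κ A : ℝ} (hκ : 0 < κ)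
    (hw : ContinuousOn w (Metric.closedBall 0 (1 / 8))) (hpos : ∀ x ∈ slab n b, 0 ≤ w x)
    (hΩ : IsOpen Ω) (hbd : ∀ x ∈ slab n b, w x < κ → x ∈ Ω ∧ 0 < lastCoord x + b)
    (hmv : ∀ x s, 0 < s → Metric.closedBall x s ⊆ Ω →
      |(∫ z, w (x + s • z) * bump z) - w x * bumpMass (E n)| ≤ s ^ 2 * A)
    (hA : A < κ) (hb : b ≤ 2 * barrierScale n) {x : E n} (hx : ‖x‖ ≤ barrierScale n)
    (hx0 : 0 ≤ lastCoord x + b) : κ / 2 ≤ w x := by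
  have hs := barrierScale_pos n
  have hs' := barrierScale_le n
  have hK := barrierCoeff_pos n
  have hc := (le_abs_self _).trans (abs_lastCoord_le x)
  -- With `‖x‖ ≤ l` and `b ≤ 2l`, the height `x_d + b` is at most `3l`, below both the threshold
  -- `4l` and the slab top `32l`.
  have h8 : 1 / (8 * (1 + barrierCoeff n)) = 4 * barrierScale n := by
    unfold barrierScale
    field_simp
    norm_num
  have h1 : 1 / (1 + barrierCoeff n) = 32 * barrierScale n := by
    unfold barrierScale
    field_simp
  refine (half_le_barrier hκ hx ?_).trans
    (barrier_le hκ hw hpos hΩ hbd hmv hA x ⟨?_, hx0, ?_⟩)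
  · rw [h8]
    linarith
  · linarith
  · rw [h1]
    linarith

/-- The gap above the lower plane is compared with the barrier based at `b = a + ε`. If it is below
`C ε`, then `x_d + a + C ε > 0` because `φ ≥ 0`, so the point lies in `Ω`. The upper bound on `φ`
then keeps it off the slab's bottom. -/
theorem lower_bound_near {φ f : E n → ℝ} {C a ε γ F : ℝ} (hC : 0 < C) (hε : 0 < ε) (hγ : 0 < γ)
    (hF : 0 ≤ F) (hFC : γ⁻¹ * F * volume.real (Metric.ball (0 : E n) 1) < C * ε)
    (ha : a + ε ≤ 2 * barrierScale n) (hφ : ContinuousOn φ (B n 1)) (hφ0 : ∀ x ∈ B n 1, 0 ≤ φ x)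
    (hf : ∀ᵐ x ∂volume.restrict (positivitySet φ), |f x| ≤ F)
    (hsol : SolvesPoisson (positivitySet φ) φ f)
    (hlow : ∀ x ∈ B n 1, γ * pos (lastCoord x + a) ≤ φ x)
    (hup : ∀ x ∈ B n 1, φ x ≤ γ * pos (lastCoord x + a + ε))
    (hfree : {x | 0 < lastCoord x + a + C * ε} ∩ B n (1 / 4) ⊆ positivitySet φ)
    {x : E n} (hx : ‖x‖ ≤ barrierScale n) (hx0 : 0 ≤ lastCoord x + a + ε) :
    γ * (lastCoord x + a + C / 2 * ε) ≤ φ x := by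
  set w : E n → ℝ := fun x => γ⁻¹ * φ x + (-1 * lastCoord x + -a) with hw
  have hsub : Metric.closedBall (0 : E n) (1 / 8) ⊆ B n 1 :=
    Metric.closedBall_subset_ball (by norm_num)
  have hlc := continuous_lastCoord (n := n)
  have hle : ∀ {y t}, γ * t ≤ φ y → t ≤ γ⁻¹ * φ y := fun h => (le_inv_mul_iff₀ hγ).2 h
  have hpos : ∀ y ∈ slab n (a + ε), 0 ≤ w y := fun y hy => by
    have h1 := hle (hlow y (hsub (by simpa using hy.1)))
    have h2 : lastCoord y + a ≤ pos (lastCoord y + a) := le_max_left _ _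
    simp only [hw]
    linarith
  have hbd : ∀ y ∈ slab n (a + ε), w y < C * ε →
      y ∈ positivitySet φ ∧ 0 < lastCoord y + (a + ε) := fun y hy hlt => by
    have hy1 : y ∈ B n 1 := hsub (by simpa using hy.1)
    have hy4 : y ∈ B n (1 / 4) := mem_B.2 (hy.1.trans_lt (by norm_num))
    have hmem : y ∈ positivitySet φ := by
      refine hfree ⟨?_, hy4⟩
      have h1 : 0 ≤ γ⁻¹ * φ y := mul_nonneg (inv_pos.2 hγ).le (hφ0 y hy1)
      simp only [hw] at hlt
      simp only [mem_ofPred_eq]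
      linarith
    refine ⟨hmem, ?_⟩
    by_contra hneg
    have h2 := hup y hy1
    rw [pos, max_eq_right (by linarith), mul_zero] at h2
    exact absurd hmem.2 (not_lt.2 h2)
  have hmain := half_le_of_comparison (w := w) (mul_pos hC hε)
    ((continuousOn_const.mul (hφ.mono hsub)).add (by fun_prop)) hpos (isOpen_positivitySet hφ) hbd
    (fun y s hs hys => abs_average_sub_le_of_affine hF (hφ.mono fun _ h => h.1) hf hsol
      (fun _ => rfl) hs hys) (by rwa [abs_of_pos (inv_pos.2 hγ)]) ha hx (by linarith)
  rw [← le_inv_mul_iff₀ hγ]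
  simp only [hw] at hmain
  linarith

/-- The mirror argument, for the gap below the upper plane and the base `b = a + (1 - C) ε`. Where
`φ = 0` in the slab this gap is `x_d + a + ε ≥ C ε`, and the assumed inclusion keeps `Ω` off the
bottom. -/
theorem upper_bound_near {φ f : E n → ℝ} {C a ε γ F : ℝ} (hC : 0 < C) (hε : 0 < ε) (hγ : 0 < γ)
    (hF : 0 ≤ F) (hFC : γ⁻¹ * F * volume.real (Metric.ball (0 : E n) 1) < C * ε)
    (ha : a + ε ≤ 2 * barrierScale n) (hφ : ContinuousOn φ (B n 1)) (hφ0 : ∀ x ∈ B n 1, 0 ≤ φ x)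
    (hf : ∀ᵐ x ∂volume.restrict (positivitySet φ), |f x| ≤ F)
    (hsol : SolvesPoisson (positivitySet φ) φ f)
    (hup : ∀ x ∈ B n 1, φ x ≤ γ * pos (lastCoord x + a + ε))
    (hfree : positivitySet φ ∩ B n (1 / 4) ⊆
      {x | 0 < lastCoord x + a + (1 - C) * ε} ∩ B n (1 / 4))
    {x : E n} (hx : ‖x‖ ≤ barrierScale n) (hx0 : 0 ≤ lastCoord x + a + (1 - C) * ε) :
    φ x ≤ γ * (lastCoord x + a + (1 - C / 2) * ε) := by
  set w : E n → ℝ := fun x => -γ⁻¹ * φ x + (1 * lastCoord x + (a + ε)) with hw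
  have hsub : Metric.closedBall (0 : E n) (1 / 8) ⊆ B n 1 :=
    Metric.closedBall_subset_ball (by norm_num)
  have hlc := continuous_lastCoord (n := n)
  have hCε : 0 < C * ε := mul_pos hC hε
  have hle : ∀ {y t}, φ y ≤ γ * t → γ⁻¹ * φ y ≤ t := fun h => (inv_mul_le_iff₀ hγ).2 h
  have hpos : ∀ y ∈ slab n (a + (1 - C) * ε), 0 ≤ w y := fun y hy => by
    have h1 := hle (hup y (hsub (by simpa using hy.1)))
    have h2 := hy.2.1
    rw [pos, max_eq_left (by linarith)] at h1
    simp only [hw]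
    linarith
  have hbd : ∀ y ∈ slab n (a + (1 - C) * ε), w y < C * ε →
      y ∈ positivitySet φ ∧ 0 < lastCoord y + (a + (1 - C) * ε) := fun y hy hlt => by
    have hy1 : y ∈ B n 1 := hsub (by simpa using hy.1)
    have hy4 : y ∈ B n (1 / 4) := mem_B.2 (hy.1.trans_lt (by norm_num))
    have hmem : y ∈ positivitySet φ := by
      refine ⟨hy1, ?_⟩
      by_contra hneg
      have h0 : φ y = 0 := le_antisymm (not_lt.1 hneg) (hφ0 y hy1)
      have h2 := hy.2.1
      simp only [hw, h0] at hlt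
      linarith
    refine ⟨hmem, ?_⟩
    have : 0 < lastCoord y + a + (1 - C) * ε := (hfree ⟨hmem, hy4⟩).1
    linarith
  have hmain := half_le_of_comparison (w := w) hCε
    ((continuousOn_const.mul (hφ.mono hsub)).add (by fun_prop)) hpos (isOpen_positivitySet hφ) hbd
    (fun y s hs hys => abs_average_sub_le_of_affine hF (hφ.mono fun _ h => h.1) hf hsol
      (fun _ => rfl) hs hys) (by rwa [abs_neg, abs_of_pos (inv_pos.2 hγ)])
    (by linarith) hx (by linarith)
  rw [← inv_mul_le_iff₀ hγ]
  simp only [hw] at hmain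
  linarith

end GainSpace

/-! ### Choice of constants and the two regimes. -/

open GainSpace in
theorem lemma4p2 (n : ℕ) (C : ℝ) (hC0 : 0 < C) (hC1 : C < 1) :
    ∃ ε₀ : ℝ, 0 < ε₀ ∧ ∃ δ : ℝ, 0 < δ ∧ δ < 1 ∧ ∃ ρ : ℝ, 0 < ρ ∧ ρ < 1 ∧
      ∀ (ε a γ : ℝ) (φ f : GainSpace.E n → ℝ),
        0 < ε → ε ≤ ε₀ → |a| ≤ 1 → 0 < γ →
        ContinuousOn φ (GainSpace.B n 1) →
        (∀ x ∈ GainSpace.B n 1, 0 ≤ φ x) →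
        MemLp f ∞ (volume.restrict (GainSpace.B n 1)) →
        eLpNorm f ∞ (volume.restrict (GainSpace.B n 1)) ≤ ENNReal.ofReal (ε₀ * γ * ε) →
        GainSpace.SolvesPoisson (GainSpace.positivitySet φ) φ f →
        (∀ x ∈ GainSpace.B n 1,
          γ * GainSpace.pos (GainSpace.lastCoord x + a) ≤ φ x ∧
          φ x ≤ γ * GainSpace.pos (GainSpace.lastCoord x + a + ε)) →
        ({x | 0 < GainSpace.lastCoord x + a + C * ε} ∩ GainSpace.B n (1 / 4) ⊆
            GainSpace.positivitySet φ ∨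
          GainSpace.positivitySet φ ∩ GainSpace.B n (1 / 4) ⊆
            {x | 0 < GainSpace.lastCoord x + a + (1 - C) * ε} ∩ GainSpace.B n (1 / 4)) →
        (∀ x ∈ GainSpace.B n ρ,
          γ * GainSpace.pos (GainSpace.lastCoord x + a + δ * ε) ≤ φ x) ∨
        (∀ x ∈ GainSpace.B n ρ,
          φ x ≤ γ * GainSpace.pos (GainSpace.lastCoord x + a + (1 - δ) * ε)) := by
  set M := volume.real (Metric.ball (0 : E n) 1)
  have hM : 0 ≤ M := measureReal_nonneg
  have hm := bumpMass_pos (V := E n)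
  set m := bumpMass (E n)
  have hl := barrierScale_pos n
  have hl' := barrierScale_le n
  set l := barrierScale n
  obtain ⟨ρ, hρ, hρl, hosc⟩ := exists_oscillation_radius n hl (by linarith)
  have hdiv : ∀ {c : ℝ}, 0 < c → c / (M + 1) * M < c := fun {c} hc => by
    rw [div_mul_eq_mul_div, div_lt_iff₀ (by positivity)]
    nlinarith
  -- The three entries serve `a + ε ≤ 2l`, the barrier's condition `A < κ`, and the oscillation
  -- error; `M + 1` keeps the inequalities strict.
  set ε₀ := min (l / 2) (min (C / (M + 1)) (m / 16 / (M + 1)))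
  have hε₀ : 0 < ε₀ := by positivity
  have hε₀l : ε₀ ≤ l / 2 := min_le_left _ _
  have hε₀C : ε₀ * M < C := (mul_le_mul_of_nonneg_right
    ((min_le_right _ _).trans (min_le_left _ _)) hM).trans_lt (hdiv hC0)
  have hε₀m : ε₀ * M < m / 16 := (mul_le_mul_of_nonneg_right
    ((min_le_right _ _).trans (min_le_right _ _)) hM).trans_lt (hdiv (by positivity))
  -- `C / 2` is the gain from the barrier, `1 / 4` the gain from the oscillation estimate.
  set δ := min (C / 2) (1 / 4)
  have hδ : 0 < δ := by positivity
  have hδC : δ ≤ C / 2 := min_le_left _ _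
  have hδ4 : δ ≤ 1 / 4 := min_le_right _ _
  refine ⟨ε₀, hε₀, δ, hδ, by linarith, ρ, hρ, by linarith, ?_⟩
  intro ε a γ φ f hε hεε₀ _ hγ hφ hφ0 _ hf hsol hbounds hfree
  have hF : 0 ≤ ε₀ * γ * ε := by positivity
  have hf' : ∀ᵐ x ∂volume.restrict (positivitySet φ), |f x| ≤ ε₀ * γ * ε :=
    ae_restrict_of_ae_restrict_of_subset (fun _ h => h.1) (ae_abs_le_of_eLpNorm_top_le hF hf)
  have hlow := fun x hx => (hbounds x hx).1
  have hup := fun x hx => (hbounds x hx).2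
  have hδε : δ * ε ≤ C / 2 * ε := mul_le_mul_of_nonneg_right hδC hε.le
  have hδε4 : δ * ε ≤ 1 / 4 * ε := mul_le_mul_of_nonneg_right hδ4 hε.le
  have hFγ : γ⁻¹ * (ε₀ * γ * ε) * M = ε₀ * M * ε := by field_simp
  have hB1 : ∀ x ∈ B n ρ, x ∈ B n 1 := fun x hx => mem_B.2 ((mem_B.1 hx).trans (by linarith))
  have hlower : ∀ x ∈ B n ρ, (0 < lastCoord x + a + δ * ε →
      γ * (lastCoord x + a + δ * ε) ≤ φ x) → γ * pos (lastCoord x + a + δ * ε) ≤ φ x := by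
    intro x hx h
    rcases le_or_gt (lastCoord x + a + δ * ε) 0 with h0 | h0
    · rw [pos, max_eq_right h0, mul_zero]
      exact hφ0 x (hB1 x hx)
    · rw [pos, max_eq_left h0.le]
      exact h h0
  have hposle : ∀ {s t : ℝ}, s ≤ t → γ * s ≤ γ * pos t := fun h =>
    mul_le_mul_of_nonneg_left (h.trans (le_max_left _ _)) hγ.le
  rcases le_or_gt a l with hal | hal
  · have haε : a + ε ≤ 2 * l := by linarith
    have hFC : γ⁻¹ * (ε₀ * γ * ε) * M < C * ε := by
      rw [hFγ]
      exact mul_lt_mul_of_pos_right hε₀C hε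
    rcases hfree with hfree | hfree
    · refine Or.inl fun x hx => hlower x hx fun h0 => ?_
      refine le_trans ?_ (lower_bound_near hC0 hε hγ hF hFC haε hφ hφ0 hf' hsol hlow hup hfree
        (by have := mem_B.1 hx; linarith) (by linarith))
      exact mul_le_mul_of_nonneg_left (by linarith) hγ.le
    · refine Or.inr fun x hx => ?_
      rcases le_or_gt 0 (lastCoord x + a + (1 - C) * ε) with h0 | h0
      · exact (upper_bound_near hC0 hε hγ hF hFC haε hφ hφ0 hf' hsol hup hfree
          (by have := mem_B.1 hx; linarith) h0).trans (hposle (by linarith))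
      -- Below the slab the inclusion itself forces `φ = 0`.
      · have hx4 : x ∈ B n (1 / 4) := mem_B.2 ((mem_B.1 hx).trans (by linarith))
        have h1 : φ x ≤ 0 := by
          by_contra hpos
          have : 0 < lastCoord x + a + (1 - C) * ε :=
            (hfree ⟨⟨hB1 x hx, not_le.1 hpos⟩, hx4⟩).1
          linarith
        exact h1.trans (mul_nonneg hγ.le (le_max_right _ _))
  -- Far from the free boundary: `x_d + a > 0` throughout `B_l`, so both positive parts are affine
  -- there.
  · set w : E n → ℝ := fun x => γ⁻¹ * φ x + (-1 * lastCoord x + -a) with hw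
    have hsub : ∀ x ∈ Metric.ball (0 : E n) l, x ∈ B n 1 ∧ 0 < lastCoord x + a := fun x hx => by
      rw [mem_ball_zero_iff] at hx
      have := (abs_le.1 (abs_lastCoord_le x)).1
      exact ⟨mem_B.2 (by linarith), by linarith⟩
    have hΩ : Metric.ball (0 : E n) l ⊆ positivitySet φ := fun x hx => by
      obtain ⟨h1, h2⟩ := hsub x hx
      refine ⟨h1, lt_of_lt_of_le ?_ (hlow x h1)⟩
      exact mul_pos hγ (lt_max_of_lt_left h2)
    have hlc := continuous_lastCoord (n := n)
    have hwε : ∀ x ∈ Metric.ball (0 : E n) l, 0 ≤ w x ∧ w x ≤ ε := fun x hx => by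
      obtain ⟨h1, h2⟩ := hsub x hx
      have h3 := hlow x h1
      have h4 := hup x h1
      rw [pos, max_eq_left h2.le, ← le_inv_mul_iff₀ hγ] at h3
      rw [pos, max_eq_left (by linarith), ← inv_mul_le_iff₀ hγ] at h4
      simp only [hw]
      constructor <;> linarith
    have hdist := hosc w ε hε
      ((continuousOn_const.mul (hφ.mono fun x hx => (hsub x hx).1)).add (by fun_prop)) hwε
      fun x s hs hxs => by
        refine (abs_average_sub_le_of_affine hF (hφ.mono fun _ h => h.1) hf' hsol
          (fun _ => rfl) hs (hxs.trans hΩ)).trans ?_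
        rw [abs_of_pos (inv_pos.2 hγ), hFγ]
        gcongr
    rcases le_or_gt (ε / 2) (w 0) with h0 | h0
    · refine Or.inl fun x hx => hlower x hx fun _ => ?_
      have := (abs_le.1 (hdist x hx)).1
      have h1 : lastCoord x + a + δ * ε ≤ γ⁻¹ * φ x := by
        have : w x = γ⁻¹ * φ x + (-1 * lastCoord x + -a) := rfl
        linarith
      exact (le_inv_mul_iff₀ hγ).1 h1
    · refine Or.inr fun x hx => ?_
      have := (abs_le.1 (hdist x hx)).2
      have h1 : γ⁻¹ * φ x ≤ lastCoord x + a + (1 - δ) * ε := by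
        have : w x = γ⁻¹ * φ x + (-1 * lastCoord x + -a) := rfl
        linarith
      exact ((inv_mul_le_iff₀ hγ).1 h1).trans (hposle le_rfl)
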